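/- Let $\mathbb{H}$ be the upper half plane and $q = e^{2\pi i z}$, let $\mathrm{M}_v$ denote the space of (holomorphic) modular forms of weight $v$ for $\mathrm{SL}_2(\mathbb{Z})$, and let $E_2(z) = 1 - 24\sum_{n\ge 1}\sigma_1(n)q^n$. For integers $\ell, w \ge 0$ let $\widetilde{\mathrm{M}}_{\ell,w}$ be the complex vector space of functions $f = \sum_{j=0}^{\ell} f_j E_2^j$ on $\mathbb{H}$ with $f_j \in \mathrm{M}_{w-2j}$ (quasimodular forms of weight $w$ and depth at most $\ell$), and put $\widetilde{\mathrm{M}}_{-1,w} = \{0\}$. With $m = \dim_{\mathbb{C}} \widetilde{\mathrm{M}}_{\ell,w}$, a form $f = \sum_{n\ge 0} a_n q^n \in \widetilde{\mathrm{M}}_{\ell,w}\setminus \widetilde{\mathrm{M}}_{\ell-1,w}$ is called a normalized extremal quasimodular form of weight $w$ and depth $\ell$ if $a_0 = \dots = a_{m-2} = 0$ and $a_{m-1} = 1$. **Theorem.** For every integer $k \ge 0$ there is exactly one normalized extremal quasimodular form $\widetilde{f}_{1,6k+2}$ of weight $6k+2$ and depth $1$, and $$\widetilde{f}_{1,6k+2}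 \in \mathbb{Z}\left[\tfrac{1}{p} : p \text{ prime},\ p < 6k+2\right][[q]].$$ In particular, every Fourier coefficient of $\widetilde{f}_{1,6k+2}$ is a rational number, and every prime dividing its denominator (in lowest terms) is smaller than the weight $6k+2$. -/

import Mathlib

open scoped UpperHalfPlane MatrixGroups

noncomputable section

/-- The complex vector space of quasimodular forms of weight `w` and depth at most `ℓ` on
`SL(2, ℤ)`: the functions `∑_{j ≤ ℓ} f_j E₂ ^ j` on the upper half plane, where `f_j` is a modular
form of weight `w - 2 j` and level one (so `f_j = 0` when `w < 2 j`). -/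
def quasimodularSpace (ℓ w : ℕ) : Submodule ℂ (ℍ → ℂ) where
  carrier := {f | ∃ g : (j : ℕ) → ModularForm 𝒮ℒ ((w : ℤ) - 2 * (j : ℤ)),
    ∀ z : ℍ, f z = ∑ j ∈ Finset.range (ℓ + 1), g j z * EisensteinSeries.E2 z ^ j}
  zero_mem' := ⟨fun _ => 0, fun z => by simp⟩
  add_mem' := by
    rintro f₁ f₂ ⟨g₁, h₁⟩ ⟨g₂, h₂⟩
    exact ⟨fun j => g₁ j + g₂ j, fun z => by
      simp [h₁ z, h₂ z, add_mul, Finset.sum_add_distrib]⟩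
  smul_mem' := by
    rintro c f ⟨g, h⟩
    exact ⟨fun j => c • g j, fun z => by
      simp [h z, Finset.mul_sum, mul_assoc]⟩

/-- The `n`-th Fourier coefficient `a_n` of `f(z) = ∑ a_n q ^ n`, with `q = exp (2 π i z)`. -/
def fourierCoeffQ (f : ℍ → ℂ) (n : ℕ) : ℂ :=
  (UpperHalfPlane.qExpansion 1 f).coeff n

/-- `f` is an extremal quasimodular form of weight `w` and (exact) depth `ℓ`. -/
structure IsExtremalQuasimodular (ℓ w : ℕ) (f : ℍ → ℂ) : Prop where
  mem : f ∈ quasimodularSpace ℓ w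
  depth : ∀ j < ℓ, f ∉ quasimodularSpace j w
  coeff_eq_zero : ∀ n : ℕ, n + 1 < Module.finrank ℂ (quasimodularSpace ℓ w) →
    fourierCoeffQ f n = 0
  coeff_ne_zero : fourierCoeffQ f (Module.finrank ℂ (quasimodularSpace ℓ w) - 1) ≠ 0

/-- `f` is a normalized extremal quasimodular form of weight `w` and depth `ℓ`: its first nonzero
Fourier coefficient is `1`. -/
structure IsNormalizedExtremalQuasimodular (ℓ w : ℕ) (f : ℍ → ℂ) : Prop where
  extremal : IsExtremalQuasimodular ℓ w f
  normalized : fourierCoeffQ f (Module.finrank ℂ (quasimodularSpace ℓ w) - 1) = 1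

/-- The subring `ℤ[1/p : p prime, p < N]` of `ℂ`. -/
def intAdjoinInvPrimes (N : ℕ) : Subalgebra ℤ ℂ :=
  Algebra.adjoin ℤ {x : ℂ | ∃ p : ℕ, p.Prime ∧ p < N ∧ x = 1 / (p : ℂ)}

end

open scoped PowerSeries Manifold ModularForm ArithmeticFunction.sigma
open UpperHalfPlane (qExpansion cuspFunction IsBoundedAtImInfty)
open ModularForm (E₄ E₆)

/-! Write D = q d/dq and P, Q, R for the q-expansions of E₂, E₄, E₆. Start from (F, G) = (1, P) and
pass repeatedly to multiples of (R F - Q G, Q² F - R G). Each pass raises both weights by 6, and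
Ramanujan's equations show that a linear first-order system linking F and G (`IsExtremalPair`) is
reproduced with n + 1 in place of n. The order of vanishing rises by one, and the system yields the
new leading coefficients -144(6n+5)/(n+1) and 144(6n+7)/(n+1) (`coeff_step_F`, `coeff_step_G`).
Normalizing therefore divides only by 2, 3 and the prime factors of 6n+5 and 6n+7, all below the new
weight 6n+8; everything else in the recursion is integral.

Uniqueness is linear algebra. The forms E₆^(k-j) G_j with j ≤ k have leading terms q^j and the space
has dimension at most k + 1, so the first k + 1 Fourier coefficients are coordinates on it
(`fourierCoeffMap_injective`). The depth is exactly 1 because a nonzero modular form of weight 6k +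
2 cannot vanish to order k (`extremalPair_snd_not_mem`). -/

/-! ### Calculus of q-expansions. -/

/-- Holomorphic one-periodic functions on the upper half plane bounded at `i∞`. -/
structure IsQRegular (f : ℍ → ℂ) : Prop where
  periodic : Function.Periodic (f ∘ UpperHalfPlane.ofComplex) ((1 : ℝ) : ℂ)
  mdiff : MDiff f
  bdd : IsBoundedAtImInfty f

namespace IsQRegular

variable {f g : ℍ → ℂ}

lemma analyticAt (hf : IsQRegular f) : AnalyticAt ℂ (cuspFunction 1 f) 0 :=
  UpperHalfPlane.analyticAt_cuspFunction_zero one_pos hf.periodic hf.mdiff hf.bdd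

lemma add (hf : IsQRegular f) (hg : IsQRegular g) : IsQRegular (f + g) :=
  ⟨fun z => congrArg₂ (· + ·) (hf.periodic z) (hg.periodic z), hf.mdiff.add hg.mdiff,
    hf.bdd.add hg.bdd⟩

lemma mul (hf : IsQRegular f) (hg : IsQRegular g) : IsQRegular (f * g) :=
  ⟨fun z => congrArg₂ (· * ·) (hf.periodic z) (hg.periodic z), hf.mdiff.mul hg.mdiff,
    hf.bdd.mul hg.bdd⟩

lemma const (c : ℂ) : IsQRegular (Function.const ℍ c) :=
  ⟨fun _ => rfl, mdifferentiable_const, Filter.const_boundedAtFilter _ c⟩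

lemma smul (c : ℂ) (hf : IsQRegular f) : IsQRegular (c • f) :=
  (const c).mul hf

lemma neg (hf : IsQRegular f) : IsQRegular (-f) := by
  simpa using hf.smul (-1)

lemma sub (hf : IsQRegular f) (hg : IsQRegular g) : IsQRegular (f - g) := by
  simpa [sub_eq_add_neg] using hf.add hg.neg

lemma pow (hf : IsQRegular f) (n : ℕ) : IsQRegular (f ^ n) := by
  induction n with
  | zero => simpa using! const 1
  | succ n ih => simpa [pow_succ] using ih.mul hf

lemma of_modularForm {k : ℤ} (f : ModularForm 𝒮ℒ k) : IsQRegular f :=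
  ⟨SlashInvariantFormClass.periodic_comp_ofComplex f (by simp), f.holo',
    ModularFormClass.bdd_at_infty f⟩

lemma qExpansion_add (hf : IsQRegular f) (hg : IsQRegular g) :
    qExpansion 1 (f + g) = qExpansion 1 f + qExpansion 1 g :=
  UpperHalfPlane.qExpansion_add hf.analyticAt hg.analyticAt

lemma qExpansion_sub (hf : IsQRegular f) (hg : IsQRegular g) :
    qExpansion 1 (f - g) = qExpansion 1 f - qExpansion 1 g :=
  UpperHalfPlane.qExpansion_sub hf.analyticAt hg.analyticAt

lemma qExpansion_mul (hf : IsQRegular f) (hg : IsQRegular g) :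
    qExpansion 1 (f * g) = qExpansion 1 f * qExpansion 1 g :=
  UpperHalfPlane.qExpansion_mul hf.analyticAt hg.analyticAt

lemma qExpansion_smul (c : ℂ) (hf : IsQRegular f) :
    qExpansion 1 (c • f) = c • qExpansion 1 f :=
  UpperHalfPlane.qExpansion_smul hf.analyticAt c

lemma qExpansion_pow (hf : IsQRegular f) (n : ℕ) :
    qExpansion 1 (f ^ n) = qExpansion 1 f ^ n := by
  induction n with
  | zero => simpa using UpperHalfPlane.qExpansion_one 1
  | succ n ih => rw [pow_succ, (hf.pow n).qExpansion_mul hf, ih, pow_succ]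

/-- A holomorphic function with a convergent `q`-expansion is one-periodic and bounded at `i∞`. -/
lemma of_hasSum {c : ℕ → ℂ} (hf : MDiff f)
    (h : ∀ τ : ℍ, HasSum (fun m => c m • Function.Periodic.qParam 1 τ ^ m) (f τ)) :
    IsQRegular f where
  mdiff := hf
  bdd := UpperHalfPlane.isBoundedAtImInfty_of_hasSum_qExpansion one_pos h
  periodic := by
    intro w
    by_cases hw : 0 < w.im
    · have hw' : 0 < (w + ((1 : ℝ) : ℂ)).im := by simpa using hw
      simp only [Function.comp_apply, UpperHalfPlane.ofComplex_apply_of_im_pos hw,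
        UpperHalfPlane.ofComplex_apply_of_im_pos hw']
      refine (h _).unique ?_
      convert! h ⟨w, hw⟩ using 4
      simp [Function.Periodic.qParam, mul_add, Complex.exp_add]
    · have hw' : ¬ 0 < (w + ((1 : ℝ) : ℂ)).im := by simpa using hw
      simp only [Function.comp_apply, UpperHalfPlane.ofComplex_apply_of_im_nonpos (not_lt.mp hw),
        UpperHalfPlane.ofComplex_apply_of_im_nonpos (not_lt.mp hw')]

lemma coeff_qExpansion_of_hasSum {c : ℕ → ℂ} (hf : MDiff f)
    (h : ∀ τ : ℍ, HasSum (fun m => c m • Function.Periodic.qParam 1 τ ^ m) (f τ)) (m : ℕ) :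
    (qExpansion 1 f).coeff m = c m := by
  have hf' := (of_hasSum hf h).analyticAt
  have h1 := (UpperHalfPlane.hasFPowerSeriesOnBall_cuspFunction one_pos hf' h).hasFPowerSeriesAt
  have h2 := congr_arg (FormalMultilinearSeries.coeff · m)
    (h1.eq_formalMultilinearSeries hf'.hasFPowerSeriesAt)
  simp only [FormalMultilinearSeries.coeff_ofScalars] at h2
  rw [h2, UpperHalfPlane.qExpansion_coeff, div_eq_inv_mul]

open Derivative

/-- By the chain rule, f = Φ(q) gives D f = q Φ'(q); the Taylor series of Φ' on the unit disc,
shifted by one, is the series sought. -/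
lemma hasSum_normalizedDeriv (hf : IsQRegular f) (τ : ℍ) :
    HasSum (fun m : ℕ => ((m : ℂ) * (qExpansion 1 f).coeff m) •
      Function.Periodic.qParam 1 τ ^ m) (normalizedDerivOfComplex f τ) := by
  set q := Function.Periodic.qParam 1 (τ : ℂ) with hq
  have hq1 : ‖q‖ < 1 := Function.Periodic.norm_qParam_lt_one one_pos τ.im_pos
  have hdiff := UpperHalfPlane.differentiableOn_cuspFunction_ball one_pos hf.periodic hf.mdiff
    hf.bdd
  have hderiv : normalizedDerivOfComplex f τ = q * deriv (cuspFunction 1 f) q := by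
    have h1 : HasDerivAt (Function.Periodic.qParam 1) (2 * Real.pi * Complex.I * q) (τ : ℂ) := by
      have : HasDerivAt (fun z : ℂ => 2 * Real.pi * Complex.I * z / ((1 : ℝ) : ℂ))
          (2 * Real.pi * Complex.I) (τ : ℂ) := by
        simpa using ((hasDerivAt_id (τ : ℂ)).const_mul (2 * Real.pi * Complex.I))
      convert! this.cexp using 1
      rw [hq, Function.Periodic.qParam, mul_comm]
    have h2 : HasDerivAt (cuspFunction 1 f) (deriv (cuspFunction 1 f) q) q :=
      ((hdiff q (by simpa using hq1)).differentiableAt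
        (Metric.isOpen_ball.mem_nhds (by simpa using hq1))).hasDerivAt
    have h3 : (f ∘ UpperHalfPlane.ofComplex) =
        cuspFunction 1 f ∘ Function.Periodic.qParam 1 := by
      ext w
      exact (Function.Periodic.eq_cuspFunction one_ne_zero hf.periodic w).symm
    rw [normalizedDerivOfComplex, h3, (h2.comp (τ : ℂ) h1).deriv]
    have := Complex.two_pi_I_ne_zero
    field_simp
  have hsum := Complex.hasSum_taylorSeries_on_ball (hdiff.deriv Metric.isOpen_ball)
    (z := q) (by simpa using hq1)
  rw [hderiv, ← hasSum_nat_add_iff' 1]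
  simp only [Finset.range_one, Finset.sum_singleton, Nat.cast_zero, zero_mul, zero_smul, sub_zero]
  convert! hsum.mul_left q using 1
  ext m
  rw [UpperHalfPlane.qExpansion_coeff, iteratedDeriv_succ', Nat.factorial_succ, pow_succ]
  have h1 : ((m : ℂ) + 1) ≠ 0 := by exact_mod_cast m.succ_ne_zero
  have h2 : ((m.factorial : ℕ) : ℂ) ≠ 0 := by exact_mod_cast m.factorial_ne_zero
  simp only [smul_eq_mul, sub_zero]
  push_cast
  field_simp

lemma normalizedDeriv (hf : IsQRegular f) : IsQRegular (normalizedDerivOfComplex f) :=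
  of_hasSum (normalizedDerivOfComplex_mdifferentiable hf.mdiff) hf.hasSum_normalizedDeriv

lemma qExpansion_normalizedDeriv (hf : IsQRegular f) :
    qExpansion 1 (normalizedDerivOfComplex f) = PowerSeries.X * d⁄dX ℂ (qExpansion 1 f) := by
  ext m
  rw [coeff_qExpansion_of_hasSum (normalizedDerivOfComplex_mdifferentiable hf.mdiff)
    hf.hasSum_normalizedDeriv]
  cases m with
  | zero => simp
  | succ m => simp [PowerSeries.coeff_succ_X_mul, PowerSeries.coeff_derivative, mul_comm]

end IsQRegular

/-! ### Fourier expansions of E₂, E₄, E₆. -/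

lemma E2_hasSum (τ : ℍ) :
    HasSum (fun m => (if m = 0 then 1 else -24 * (σ 1 m : ℂ)) •
      Function.Periodic.qParam 1 τ ^ m) (EisensteinSeries.E2 τ) := by
  have hS : Summable fun n : ℕ =>
      (σ 1 (n + 1) : ℂ) * Function.Periodic.qParam 1 τ ^ (n + 1) := by
    have := (summable_nat_add_iff 1).mpr
      (EisensteinSeries.summable_sigma_mul_cexp_pow (k := 2) (by norm_num) τ)
    simpa [Function.Periodic.qParam] using this
  rw [← hasSum_nat_add_iff' 1]
  have hval : EisensteinSeries.E2 τ - 1 = -24 * ∑' n : ℕ,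
      (σ 1 (n + 1) : ℂ) * Function.Periodic.qParam 1 τ ^ (n + 1) := by
    rw [EisensteinSeries.E2_eq_tsum_cexp, ← tsum_pnat_eq_tsum_succ
      (f := fun n => (σ 1 n : ℂ) * Function.Periodic.qParam 1 τ ^ n)]
    simp only [Function.Periodic.qParam, Complex.ofReal_one, div_one]
    ring
  simp only [Nat.add_eq_zero_iff, one_ne_zero, and_false, ↓reduceIte, smul_eq_mul,
    Finset.range_one, Finset.sum_singleton, pow_zero, mul_one, hval]
  convert! (hS.hasSum).mul_left (-24 : ℂ) using 1
  ext n
  ring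

lemma E2_isQRegular : IsQRegular EisensteinSeries.E2 :=
  .of_hasSum E2_mdifferentiable E2_hasSum

lemma E2_qExpansion_coeff (m : ℕ) :
    (qExpansion 1 EisensteinSeries.E2).coeff m = if m = 0 then 1 else -24 * (σ 1 m : ℂ) :=
  IsQRegular.coeff_qExpansion_of_hasSum E2_mdifferentiable E2_hasSum m

lemma E₄_qExpansion_coeff (m : ℕ) :
    (qExpansion 1 E₄).coeff m = if m = 0 then 1 else 240 * (σ 3 m : ℂ) := by
  rw [EisensteinSeries.E_qExpansion_coeff _ ⟨2, rfl⟩]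
  norm_num [show bernoulli 4 = -1 / 30 by decide +kernel]

lemma E₆_qExpansion_coeff (m : ℕ) :
    (qExpansion 1 E₆).coeff m = if m = 0 then 1 else -504 * (σ 5 m : ℂ) := by
  rw [EisensteinSeries.E_qExpansion_coeff _ ⟨3, rfl⟩]
  norm_num [show bernoulli 6 = 1 / 42 by decide +kernel]

/-! ### Ramanujan's differential equations. -/

/-- A regular function that is slash invariant of weight less than `12` and vanishes at `i∞` is
zero. -/
lemma IsQRegular.eq_zero_of_slash_of_coeff_zero {f : ℍ → ℂ} (hf : IsQRegular f) {k : ℤ}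
    (hk : k < 12) (hslash : ∀ γ : SL(2, ℤ), f ∣[k] γ = f)
    (h0 : (qExpansion 1 f).coeff 0 = 0) : f = 0 := by
  let F : ModularForm 𝒮ℒ k :=
    { toFun := f
      slash_action_eq' := by
        rintro _ ⟨γ, rfl⟩
        exact hslash γ
      holo' := hf.mdiff
      bdd_at_cusps' := by
        intro c hc
        rw [Subgroup.IsArithmetic.isCusp_iff_isCusp_SL2Z] at hc
        rw [OnePoint.isBoundedAt_iff_forall_SL2Z hc]
        intro γ _
        rw [hslash γ]
        exact hf.bdd }
  have hF : F = 0 := by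
    apply ModularForm.sturm_bound_levelOne
    -- Below weight 12 the Sturm bound is 0, so the constant term alone decides; negative weights
    -- are covered since `toNat` sends them to 0.
    have : k.toNat / 12 = 0 := by omega
    rw [this, Nat.cast_zero, pos_iff_ne_zero, PowerSeries.order_ne_zero_iff_constCoeff_eq_zero,
      ← PowerSeries.coeff_zero_eq_constantCoeff_apply]
    exact h0
  exact congrArg (fun G : ModularForm 𝒮ℒ k => (G : ℍ → ℂ)) hF

open Derivative in
lemma normalizedDeriv_D2 (γ : SL(2, ℤ)) (z : ℍ) :
    normalizedDerivOfComplex (EisensteinSeries.D2 γ) z =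
      -((γ 1 0 : ℂ) / UpperHalfPlane.denom γ z) ^ 2 := by
  have h := (UpperHalfPlane.hasDerivAt_denom_zpow (γ : GL (Fin 2) ℝ) (-1) z).const_mul
    (2 * Real.pi * Complex.I * (γ 1 0 : ℂ))
  have hD : (EisensteinSeries.D2 γ ∘ UpperHalfPlane.ofComplex) =ᶠ[nhds (z : ℂ)]
      fun w => 2 * Real.pi * Complex.I * (γ 1 0 : ℂ) *
        UpperHalfPlane.denom (γ : GL (Fin 2) ℝ) w ^ (-1 : ℤ) := by
    filter_upwards [UpperHalfPlane.isOpen_upperHalfPlaneSet.mem_nhds z.im_pos] with w hw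
    simp [EisensteinSeries.D2, UpperHalfPlane.ofComplex_apply_of_im_pos hw, div_eq_mul_inv]
  rw [normalizedDerivOfComplex, (h.congr_of_eventuallyEq hD).deriv]
  have h1 := Complex.two_pi_I_ne_zero
  have h2 := UpperHalfPlane.denom_ne_zero (γ : GL (Fin 2) ℝ) z
  simp
  field_simp
  simp

/-- The transformation law of E₂ makes `D2 γ` a multiple of E₂|γ - E₂, which is holomorphic. -/
lemma D2_mdifferentiable (γ : SL(2, ℤ)) : MDiff (EisensteinSeries.D2 γ) := by
  have : EisensteinSeries.D2 γ = (-(1 / (2 * riemannZeta 2))⁻¹ : ℂ) •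
      (EisensteinSeries.E2 ∣[(2 : ℤ)] γ - EisensteinSeries.E2) := by
    have hz : riemannZeta 2 ≠ 0 := riemannZeta_ne_zero_of_one_lt_re (by norm_num)
    rw [EisensteinSeries.E2_slash_action]
    ext z
    simp
    field_simp
  rw [this]
  exact (((E2_mdifferentiable.slash 2 _).sub E2_mdifferentiable).const_smul _)

open Derivative in
-- The parameter is 1 although E₂ has weight 2: D E₂ - E₂²/12 is the combination in which the
-- anomalous terms of D E₂ and of E₂² cancel.
lemma serreDerivative_one_E2_slash (γ : SL(2, ℤ)) :
    serreDerivative 1 EisensteinSeries.E2 ∣[(4 : ℤ)] γ =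
      serreDerivative 1 EisensteinSeries.E2 := by
  set c : ℂ := 1 / (2 * riemannZeta 2) with hc
  have hslash := EisensteinSeries.E2_slash_action γ
  rw [← hc] at hslash
  have h1 := normalizedDerivOfComplex_SL_slash (k := 2) E2_mdifferentiable (γ := γ)
  rw [hslash, normalizedDerivOfComplex_sub _ _ E2_mdifferentiable
    ((D2_mdifferentiable γ).const_smul c), normalizedDerivOfComplex_smul c _ (D2_mdifferentiable γ)]
    at h1
  have h2 := ModularForm.mul_slash_SL2 2 2 γ EisensteinSeries.E2 EisensteinSeries.E2
  ext z
  have h1z := congrFun h1 z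
  have h2z := congrFun h2 z
  simp only [hslash] at h2z
  simp only [Pi.sub_apply, Pi.smul_apply, Pi.mul_apply, smul_eq_mul, normalizedDeriv_D2,
    EisensteinSeries.D2] at h1z h2z
  have h3 : (serreDerivative 1 EisensteinSeries.E2 ∣[(4 : ℤ)] γ) z =
      (normalizedDerivOfComplex EisensteinSeries.E2 ∣[(4 : ℤ)] γ) z -
        12⁻¹ * ((EisensteinSeries.E2 * EisensteinSeries.E2) ∣[(2 + 2 : ℤ)] γ) z := by
    simp only [ModularForm.SL_slash_apply, serreDerivative_apply, Pi.mul_apply]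
    norm_num
    ring
  rw [h3, h2z, serreDerivative_apply]
  have hc2 : c * Real.pi ^ 2 = 3 := by
    rw [hc, riemannZeta_two]
    field_simp
    norm_num
  -- With s = 2πi and t = γ₁₀/denom, the law reads E₂|γ = E₂ - c s t. The value c s² = -12 cancels
  -- both the t² terms and the t E₂ terms.
  have hs := mul_inv_cancel₀ Complex.two_pi_I_ne_zero
  have hcs : c * (2 * Real.pi * Complex.I) ^ 2 = -12 := by
    linear_combination 4 * Complex.I ^ 2 * hc2 + 12 * Complex.I_sq
  rw [mul_div_assoc] at h1z ⊢
  push_cast at h1z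
  generalize (2 * (Real.pi : ℂ) * Complex.I) = s at *
  generalize (γ 1 0 : ℂ) / UpperHalfPlane.denom γ z = t at *
  have hcw : c * s = -12 * s⁻¹ := by linear_combination s⁻¹ * hcs - c * s * hs
  linear_combination -h1z - 2 * c * t ^ 2 * hs - (c * t ^ 2 / 12) * hcs +
    (t * EisensteinSeries.E2 z / 6) * hcw

open Derivative in
theorem ramanujan_E2 : normalizedDerivOfComplex EisensteinSeries.E2 =
    (12⁻¹ : ℂ) • (EisensteinSeries.E2 * EisensteinSeries.E2 - ⇑E₄) := by
  have h2 := E2_isQRegular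
  have h4 := IsQRegular.of_modularForm E₄
  have hreg := h2.normalizedDeriv.sub (((h2.mul h2).sub h4).smul (12⁻¹ : ℂ))
  refine sub_eq_zero.mp (hreg.eq_zero_of_slash_of_coeff_zero (k := 4) (by norm_num) ?_ ?_)
  -- The difference is a Serre derivative plus a multiple of E₄, hence invariant in weight 4; its
  -- constant term vanishes, so it is zero. The other two equations follow the same pattern.
  · intro γ
    have h : normalizedDerivOfComplex EisensteinSeries.E2 -
        (12⁻¹ : ℂ) • (EisensteinSeries.E2 * EisensteinSeries.E2 - ⇑E₄) =
        serreDerivative 1 EisensteinSeries.E2 + (12⁻¹ : ℂ) • ⇑E₄ := by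
      ext z
      simp
      ring
    rw [h, SlashAction.add_slash, serreDerivative_one_E2_slash, ModularForm.SL_smul_slash]
    congr 2
    exact E₄.slash_action_eq' _ ⟨γ, rfl⟩
  · rw [h2.normalizedDeriv.qExpansion_sub (((h2.mul h2).sub h4).smul _),
      ((h2.mul h2).sub h4).qExpansion_smul, (h2.mul h2).qExpansion_sub h4, h2.qExpansion_mul h2,
      h2.qExpansion_normalizedDeriv]
    have e2 := E2_qExpansion_coeff 0
    have e4 := E₄_qExpansion_coeff 0
    simp at e2 e4
    simp [e2, e4]

open Derivative in
theorem ramanujan_E₄ : normalizedDerivOfComplex E₄ =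
    (3⁻¹ : ℂ) • (EisensteinSeries.E2 * ⇑E₄ - ⇑E₆) := by
  have h2 := E2_isQRegular
  have h4 := IsQRegular.of_modularForm E₄
  have h6 := IsQRegular.of_modularForm E₆
  have hreg := h4.normalizedDeriv.sub (((h2.mul h4).sub h6).smul (3⁻¹ : ℂ))
  refine sub_eq_zero.mp (hreg.eq_zero_of_slash_of_coeff_zero (k := 4 + 2) (by norm_num) ?_ ?_)
  · intro γ
    have h : normalizedDerivOfComplex E₄ - (3⁻¹ : ℂ) • (EisensteinSeries.E2 * ⇑E₄ - ⇑E₆) =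
        serreDerivative (4 : ℤ) E₄ + (3⁻¹ : ℂ) • ⇑E₆ := by
      ext z
      simp
      ring
    rw [h, SlashAction.add_slash, serreDerivative_slash_invariant h4.mdiff
      (E₄.slash_action_eq' _ ⟨γ, rfl⟩), ModularForm.SL_smul_slash]
    congr 2
    exact E₆.slash_action_eq' _ ⟨γ, rfl⟩
  · rw [h4.normalizedDeriv.qExpansion_sub (((h2.mul h4).sub h6).smul _),
      ((h2.mul h4).sub h6).qExpansion_smul, (h2.mul h4).qExpansion_sub h6, h2.qExpansion_mul h4,
      h4.qExpansion_normalizedDeriv]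
    have e2 := E2_qExpansion_coeff 0
    have e4 := E₄_qExpansion_coeff 0
    have e6 := E₆_qExpansion_coeff 0
    simp at e2 e4 e6
    simp [e2, e4, e6]

open Derivative in
theorem ramanujan_E₆ : normalizedDerivOfComplex E₆ =
    (2⁻¹ : ℂ) • (EisensteinSeries.E2 * ⇑E₆ - ⇑E₄ * ⇑E₄) := by
  have h2 := E2_isQRegular
  have h4 := IsQRegular.of_modularForm E₄
  have h6 := IsQRegular.of_modularForm E₆
  have hreg := h6.normalizedDeriv.sub (((h2.mul h6).sub (h4.mul h4)).smul (2⁻¹ : ℂ))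
  refine sub_eq_zero.mp (hreg.eq_zero_of_slash_of_coeff_zero (k := 6 + 2) (by norm_num) ?_ ?_)
  · intro γ
    have h : normalizedDerivOfComplex E₆ - (2⁻¹ : ℂ) • (EisensteinSeries.E2 * ⇑E₆ - ⇑E₄ * ⇑E₄) =
        serreDerivative (6 : ℤ) E₆ + (2⁻¹ : ℂ) • (⇑E₄ * ⇑E₄) := by
      ext z
      simp
      ring
    rw [h, SlashAction.add_slash, serreDerivative_slash_invariant h6.mdiff
      (E₆.slash_action_eq' _ ⟨γ, rfl⟩), ModularForm.SL_smul_slash]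
    congr 2
    exact (E₄.mul E₄).slash_action_eq' _ ⟨γ, rfl⟩
  · rw [h6.normalizedDeriv.qExpansion_sub (((h2.mul h6).sub (h4.mul h4)).smul _),
      ((h2.mul h6).sub (h4.mul h4)).qExpansion_smul, (h2.mul h6).qExpansion_sub (h4.mul h4),
      h2.qExpansion_mul h6, h4.qExpansion_mul h4, h6.qExpansion_normalizedDeriv]
    have e2 := E2_qExpansion_coeff 0
    have e4 := E₄_qExpansion_coeff 0
    have e6 := E₆_qExpansion_coeff 0
    simp at e2 e4 e6
    simp [e2, e4, e6]

/-! ### The recursion on formal power series. -/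

/-- Power series satisfying Ramanujan's differential equations, with the initial coefficients of
the Eisenstein series of weights two, four and six. -/
structure IsRamanujanTriple (P Q R : ℂ⟦X⟧) : Prop where
  deriv_P : 12 * (PowerSeries.X * d⁄dX ℂ P) = P * P - Q
  deriv_Q : 3 * (PowerSeries.X * d⁄dX ℂ Q) = P * Q - R
  deriv_R : 2 * (PowerSeries.X * d⁄dX ℂ R) = P * R - Q * Q
  coeff_zero_P : P.coeff 0 = 1
  coeff_zero_Q : Q.coeff 0 = 1
  coeff_zero_R : R.coeff 0 = 1
  coeff_one_P : P.coeff 1 = -24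
  coeff_one_Q : Q.coeff 1 = 240
  coeff_one_R : R.coeff 1 = -504

/-- The first order differential system satisfied by the extremal quasimodular forms of weights
`6 n` and `6 n + 2`, together with their normalization. -/
structure IsExtremalPair (P Q : ℂ⟦X⟧) (n : ℕ) (F G : ℂ⟦X⟧) : Prop where
  deriv_F : 12 * (PowerSeries.X * d⁄dX ℂ F) = (6 * (n : ℂ⟦X⟧) - 1) * P * F + (6 * (n : ℂ⟦X⟧) + 1) * G
  deriv_G : 12 * (PowerSeries.X * d⁄dX ℂ G) = (6 * (n : ℂ⟦X⟧) + 1) * P * G + (6 * (n : ℂ⟦X⟧) - 1) * Q * F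
  dvd_F : PowerSeries.X ^ n ∣ F
  dvd_G : PowerSeries.X ^ n ∣ G
  coeff_F : F.coeff n = 1
  coeff_G : G.coeff n = 1

namespace IsRamanujanTriple

variable {P Q R F G : ℂ⟦X⟧} {n : ℕ}

lemma isExtremalPair_zero (h : IsRamanujanTriple P Q R) : IsExtremalPair P Q 0 1 P where
  deriv_F := by simp
  deriv_G := by linear_combination h.deriv_P
  dvd_F := by simp
  dvd_G := by simp
  coeff_F := by simp
  coeff_G := h.coeff_zero_P

lemma deriv_step_F (h : IsRamanujanTriple P Q R) (hFG : IsExtremalPair P Q n F G) :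
    12 * (PowerSeries.X * d⁄dX ℂ (R * F - Q * G)) =
      (6 * (n : ℂ⟦X⟧) + 5) * (P * (R * F - Q * G) - (Q * Q * F - R * G)) := by
  simp only [map_sub, Derivation.leibniz, smul_eq_mul]
  linear_combination 6 * F * h.deriv_R - 4 * G * h.deriv_Q + R * hFG.deriv_F - Q * hFG.deriv_G

lemma deriv_step_G (h : IsRamanujanTriple P Q R) (hFG : IsExtremalPair P Q n F G) :
    12 * (PowerSeries.X * d⁄dX ℂ (Q * Q * F - R * G)) =
      (6 * (n : ℂ⟦X⟧) + 7) * (P * (Q * Q * F - R * G) - Q * (R * F - Q * G)) := by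
  simp only [map_sub, Derivation.leibniz, smul_eq_mul]
  linear_combination 8 * Q * F * h.deriv_Q - 6 * G * h.deriv_R + Q * Q * hFG.deriv_F -
    R * hFG.deriv_G

lemma coeff_X_mul_derivative (f : ℂ⟦X⟧) (m : ℕ) :
    (PowerSeries.X * d⁄dX ℂ f).coeff m = m * f.coeff m := by
  cases m with
  | zero => simp
  | succ m => simp [PowerSeries.coeff_succ_X_mul, PowerSeries.coeff_derivative, mul_comm]

lemma coeff_C_mul_X_mul_derivative (c : ℂ) (f : ℂ⟦X⟧) (m : ℕ) :
    (PowerSeries.C c * (PowerSeries.X * d⁄dX ℂ f)).coeff m = c * (m * f.coeff m) := by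
  rw [PowerSeries.coeff_C_mul, coeff_X_mul_derivative]

/-- The leading coefficient produced by one step of the recursion. -/
lemma coeff_step_F (h : IsRamanujanTriple P Q R) (hFG : IsExtremalPair P Q n F G) :
    PowerSeries.X ^ (n + 1) ∣ R * F - Q * G ∧
      (n + 1) * (R * F - Q * G).coeff (n + 1) = -144 * (6 * n + 5) := by
  obtain ⟨f, rfl⟩ := hFG.dvd_F
  obtain ⟨g, rfl⟩ := hFG.dvd_G
  have hf0 : f.coeff 0 = 1 := by simpa [PowerSeries.coeff_X_pow_mul'] using hFG.coeff_F
  have hg0 : g.coeff 0 = 1 := by simpa [PowerSeries.coeff_X_pow_mul'] using hFG.coeff_G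
  have hU : R * (PowerSeries.X ^ n * f) - Q * (PowerSeries.X ^ n * g) =
      PowerSeries.X ^ n * (R * f - Q * g) := by ring
  have hP0 := h.coeff_zero_P
  have hQ0 := h.coeff_zero_Q
  have hR0 := h.coeff_zero_R
  have c1 : ∀ a : ℂ⟦X⟧, (PowerSeries.X ^ n * a).coeff (n + 1) = a.coeff 1 := fun a => by
    rw [add_comm n 1, PowerSeries.coeff_X_pow_mul]
  have e1 := congrArg (PowerSeries.coeff (n + 1)) hFG.deriv_F
  have e2 := congrArg (PowerSeries.coeff (n + 1)) hFG.deriv_G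
  have r1 : (6 * (n : ℂ⟦X⟧) - 1) * P * (PowerSeries.X ^ n * f) +
      (6 * (n : ℂ⟦X⟧) + 1) * (PowerSeries.X ^ n * g) = PowerSeries.X ^ n *
        (PowerSeries.C (6 * n - 1 : ℂ) * (P * f) + PowerSeries.C (6 * n + 1 : ℂ) * g) := by
    simp only [map_sub, map_add, map_mul, map_natCast, map_one, map_ofNat]
    ring
  have r2 : (6 * (n : ℂ⟦X⟧) + 1) * P * (PowerSeries.X ^ n * g) +
      (6 * (n : ℂ⟦X⟧) - 1) * Q * (PowerSeries.X ^ n * f) = PowerSeries.X ^ n *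
        (PowerSeries.C (6 * n + 1 : ℂ) * (P * g) + PowerSeries.C (6 * n - 1 : ℂ) * (Q * f)) := by
    simp only [map_sub, map_add, map_mul, map_natCast, map_one, map_ofNat]
    ring
  have r3 : (12 : ℂ⟦X⟧) = PowerSeries.C 12 := (map_ofNat PowerSeries.C 12).symm
  rw [r1, r3, coeff_C_mul_X_mul_derivative, c1, c1, map_add, PowerSeries.coeff_C_mul,
    PowerSeries.coeff_C_mul, PowerSeries.coeff_one_mul] at e1
  rw [r2, r3, coeff_C_mul_X_mul_derivative, c1, c1, map_add, PowerSeries.coeff_C_mul,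
    PowerSeries.coeff_C_mul, PowerSeries.coeff_one_mul, PowerSeries.coeff_one_mul] at e2
  rw [hU, c1]
  simp only [PowerSeries.coeff_zero_eq_constantCoeff] at hf0 hg0 hP0 hQ0 hR0
  constructor
  · rw [pow_succ]
    refine mul_dvd_mul_left _ (PowerSeries.X_dvd_iff.mpr ?_)
    simp [hf0, hg0, hQ0, hR0]
  · simp only [map_sub, PowerSeries.coeff_one_mul, hf0, hg0, hP0, hQ0, hR0, h.coeff_one_P,
      h.coeff_one_Q, h.coeff_one_R] at e1 e2 ⊢
    push_cast at e1 e2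
    -- Only the difference of the q-coefficients of f and g enters; subtracting the two equations
    -- gives (n+1)(f₁ - g₁) = 24 - 120 n.
    linear_combination (1 / 12) * e1 - (1 / 12) * e2

/-- With U = R F - Q G and V = Q² F - R G, `deriv_step_F` reads (6n+5) V = (6n+5) P U - 12 D U. So V
vanishes at least to the order n + 1, and its coefficient there is that of U times -(6n+7)/(6n+5).
-/
lemma coeff_step_G (h : IsRamanujanTriple P Q R) (hFG : IsExtremalPair P Q n F G) :
    PowerSeries.X ^ (n + 1) ∣ Q * Q * F - R * G ∧
      (n + 1) * (Q * Q * F - R * G).coeff (n + 1) = 144 * (6 * n + 7) := by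
  obtain ⟨hdvd, hcoeff⟩ := h.coeff_step_F hFG
  have hn : (6 * (n : ℂ) + 5) ≠ 0 := by exact_mod_cast (by omega : 6 * n + 5 ≠ 0)
  have hP0 := h.coeff_zero_P
  have key : ∀ m : ℕ, (6 * (n : ℂ) + 5) * (Q * Q * F - R * G).coeff m =
      (6 * n + 5) * (P * (R * F - Q * G)).coeff m - 12 * (m * (R * F - Q * G).coeff m) := by
    intro m
    have e := congrArg (PowerSeries.coeff m) (h.deriv_step_F hFG)
    rw [← map_ofNat PowerSeries.C 12, coeff_C_mul_X_mul_derivative,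
      show (6 * (n : ℂ⟦X⟧) + 5) = PowerSeries.C (6 * n + 5 : ℂ) by
        simp only [map_add, map_mul, map_natCast, map_ofNat],
      PowerSeries.coeff_C_mul, map_sub (PowerSeries.coeff m) (P * _)] at e
    linear_combination e
  obtain ⟨u, hu⟩ := hdvd
  constructor
  · rw [PowerSeries.X_pow_dvd_iff]
    intro m hm
    have hUm : (R * F - Q * G).coeff m = 0 := PowerSeries.X_pow_dvd_iff.mp ⟨u, hu⟩ m hm
    have hPUm : (P * (R * F - Q * G)).coeff m = 0 :=
      PowerSeries.X_pow_dvd_iff.mp (Dvd.dvd.mul_left ⟨u, hu⟩ P) m hm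
    simpa [hUm, hPUm, hn] using key m
  · have hPU : (P * (R * F - Q * G)).coeff (n + 1) = (R * F - Q * G).coeff (n + 1) := by
      rw [hu, show P * (PowerSeries.X ^ (n + 1) * u) = PowerSeries.X ^ (n + 1) * (P * u) by ring]
      simp only [PowerSeries.coeff_zero_eq_constantCoeff] at hP0
      simp [PowerSeries.coeff_X_pow_mul', hP0]
    have e := key (n + 1)
    rw [hPU] at e
    push_cast at e
    apply mul_left_cancel₀ hn
    linear_combination (n + 1 : ℂ) * e - (6 * n + 7 : ℂ) * hcoeff

/-- The recursion producing extremal quasimodular forms of depth one. -/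
lemma isExtremalPair_succ (h : IsRamanujanTriple P Q R) (hFG : IsExtremalPair P Q n F G) :
    IsExtremalPair P Q (n + 1)
      (-(((n + 1 : ℕ) : ℂ) * ((144 * (6 * n + 5) : ℕ) : ℂ)⁻¹) • (R * F - Q * G))
      ((((n + 1 : ℕ) : ℂ) * ((144 * (6 * n + 7) : ℕ) : ℂ)⁻¹) • (Q * Q * F - R * G)) := by
  have hn5 : (6 * (n : ℂ) + 5) ≠ 0 := by exact_mod_cast (by omega : 6 * n + 5 ≠ 0)
  have hn7 : (6 * (n : ℂ) + 7) ≠ 0 := by exact_mod_cast (by omega : 6 * n + 7 ≠ 0)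
  have hn1 : ((n : ℂ) + 1) ≠ 0 := by exact_mod_cast n.succ_ne_zero
  set c : ℂ := -(((n + 1 : ℕ) : ℂ) * ((144 * (6 * n + 5) : ℕ) : ℂ)⁻¹) with hc
  set d : ℂ := ((n + 1 : ℕ) : ℂ) * ((144 * (6 * n + 7) : ℕ) : ℂ)⁻¹ with hd
  obtain ⟨hFdvd, hFcoeff⟩ := h.coeff_step_F hFG
  obtain ⟨hGdvd, hGcoeff⟩ := h.coeff_step_G hFG
  -- The two normalizing constants have exactly the ratio that turns the system for U, V into the
  -- system of index n + 1, where 6(n+1) ∓ 1 are 6n+5 and 6n+7.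
  have hcd : (6 * n + 5 : ℂ⟦X⟧) * PowerSeries.C c = -((6 * n + 7) * PowerSeries.C d) := by
    rw [show (6 * n + 5 : ℂ⟦X⟧) = PowerSeries.C (6 * n + 5 : ℂ) by
        simp only [map_add, map_mul, map_natCast, map_ofNat],
      show (6 * n + 7 : ℂ⟦X⟧) = PowerSeries.C (6 * n + 7 : ℂ) by
        simp only [map_add, map_mul, map_natCast, map_ofNat], ← map_mul, ← map_mul,
      ← map_neg, hc, hd]
    congr 1
    push_cast
    field_simp
  have hF := h.deriv_step_F hFG
  have hG := h.deriv_step_G hFG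
  refine ⟨?_, ?_, ?_, ?_, ?_, ?_⟩
  · simp only [Derivation.map_smul]
    simp only [PowerSeries.smul_eq_C_mul]
    push_cast
    linear_combination PowerSeries.C c * hF - (Q * Q * F - R * G) * hcd
  · simp only [Derivation.map_smul]
    simp only [PowerSeries.smul_eq_C_mul]
    push_cast
    linear_combination PowerSeries.C d * hG - Q * (R * F - Q * G) * hcd
  · rw [PowerSeries.smul_eq_C_mul]
    exact hFdvd.mul_left _
  · rw [PowerSeries.smul_eq_C_mul]
    exact hGdvd.mul_left _
  · rw [PowerSeries.coeff_smul, smul_eq_mul, hc, eq_div_of_mul_eq hn1 ((mul_comm _ _).trans hFcoeff)]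
    push_cast
    field_simp
    exact div_self (by rwa [mul_comm] at hn5)
  · rw [PowerSeries.coeff_smul, smul_eq_mul, hd, eq_div_of_mul_eq hn1 ((mul_comm _ _).trans hGcoeff)]
    push_cast
    field_simp
    exact div_self (by rwa [mul_comm] at hn7)

end IsRamanujanTriple

/-! ### Rings of coefficients with bounded denominators. -/

lemma intAdjoinInvPrimes_mono {M N : ℕ} (h : M ≤ N) :
    intAdjoinInvPrimes M ≤ intAdjoinInvPrimes N :=
  Algebra.adjoin_mono fun _ ⟨p, hp, hpM, hx⟩ => ⟨p, hp, hpM.trans_le h, hx⟩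

lemma inv_natCast_mem_intAdjoinInvPrimes {N d : ℕ} (hd : d ≠ 0)
    (h : ∀ p : ℕ, p.Prime → p ∣ d → p < N) : ((d : ℂ))⁻¹ ∈ intAdjoinInvPrimes N := by
  induction d using Nat.recOnMul with
  | zero => exact absurd rfl hd
  | one => simp
  | prime p hp => exact Algebra.subset_adjoin ⟨p, hp, h p hp dvd_rfl, (one_div _).symm⟩
  | mul a b iha ihb =>
    rw [Nat.cast_mul, mul_inv]
    exact mul_mem
      (iha (left_ne_zero_of_mul hd) fun p hp hpa => h p hp (hpa.mul_right b))
      (ihb (right_ne_zero_of_mul hd) fun p hp hpb => h p hp (hpb.mul_left a))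

lemma exists_rat_of_mem_intAdjoinInvPrimes {N : ℕ} {x : ℂ} (hx : x ∈ intAdjoinInvPrimes N) :
    ∃ r : ℚ, x = (r : ℂ) ∧ ∀ p : ℕ, p.Prime → p ∣ r.den → p < N := by
  induction hx using Algebra.adjoin_induction with
  | mem x hx =>
    obtain ⟨q, hq, hqN, rfl⟩ := hx
    refine ⟨(q : ℚ)⁻¹, by simp, fun p hp hpd => ?_⟩
    rw [Rat.inv_natCast_den_of_pos hq.pos] at hpd
    exact (Nat.le_of_dvd hq.pos hpd).trans_lt hqN
  | algebraMap n => exact ⟨n, by simp, fun p hp hpd => absurd (by simpa using hpd) hp.ne_one⟩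
  | add x y _ _ ihx ihy =>
    obtain ⟨r, rfl, hr⟩ := ihx
    obtain ⟨s, rfl, hs⟩ := ihy
    refine ⟨r + s, by push_cast; rfl, fun p hp hpd => ?_⟩
    exact (hp.dvd_mul.mp (hpd.trans (Rat.add_den_dvd r s))).elim (hr p hp) (hs p hp)
  | mul x y _ _ ihx ihy =>
    obtain ⟨r, rfl, hr⟩ := ihx
    obtain ⟨s, rfl, hs⟩ := ihy
    refine ⟨r * s, by push_cast; rfl, fun p hp hpd => ?_⟩
    exact (hp.dvd_mul.mp (hpd.trans (Rat.mul_den_dvd r s))).elim (hr p hp) (hs p hp)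

/-- The power series with coefficients in a given subalgebra. -/
def coeffSubalgebra (S : Subalgebra ℤ ℂ) : Subalgebra ℤ ℂ⟦X⟧ where
  carrier := {f | ∀ n, f.coeff n ∈ S}
  mul_mem' := fun hf hg n => by
    rw [PowerSeries.coeff_mul]
    exact sum_mem fun p _ => mul_mem (hf p.1) (hg p.2)
  add_mem' := fun hf hg n => by
    rw [map_add]
    exact add_mem (hf n) (hg n)
  algebraMap_mem' := fun r n => by
    rw [eq_intCast, ← map_intCast (PowerSeries.C (R := ℂ)) r, PowerSeries.coeff_C]
    split_ifs
    exacts [intCast_mem S r, zero_mem S]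

lemma coeffSubalgebra_mono {S T : Subalgebra ℤ ℂ} (h : S ≤ T) :
    coeffSubalgebra S ≤ coeffSubalgebra T := fun _ hf n => h (hf n)

lemma smul_mem_coeffSubalgebra {S : Subalgebra ℤ ℂ} {f : ℂ⟦X⟧} {c : ℂ} (hc : c ∈ S)
    (hf : f ∈ coeffSubalgebra S) : c • f ∈ coeffSubalgebra S := fun n => by
  rw [PowerSeries.coeff_smul]
  exact mul_mem hc (hf n)

/-! ### The extremal pairs as functions on the upper half plane. -/

lemma eisenstein_isRamanujanTriple :
    IsRamanujanTriple (qExpansion 1 EisensteinSeries.E2) (qExpansion 1 E₄) (qExpansion 1 E₆) := by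
  have h2 := E2_isQRegular
  have h4 := IsQRegular.of_modularForm E₄
  have h6 := IsQRegular.of_modularForm E₆
  have cancel : ∀ (n : ℕ) [n.AtLeastTwo] (a b : ℂ⟦X⟧), a = (OfNat.ofNat n : ℂ)⁻¹ • b →
      (OfNat.ofNat n : ℂ⟦X⟧) * a = b := fun n _ a b h => by
    rw [h, PowerSeries.smul_eq_C_mul, ← map_ofNat (PowerSeries.C (R := ℂ)) n, ← mul_assoc,
      ← map_mul, mul_inv_cancel₀ (OfNat.ofNat_ne_zero n), map_one, one_mul]
  refine ⟨cancel 12 _ _ ?_, cancel 3 _ _ ?_, cancel 2 _ _ ?_, ?_, ?_, ?_, ?_, ?_, ?_⟩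
  · rw [← h2.qExpansion_normalizedDeriv, ramanujan_E2, ((h2.mul h2).sub h4).qExpansion_smul,
      (h2.mul h2).qExpansion_sub h4, h2.qExpansion_mul h2]
  · rw [← h4.qExpansion_normalizedDeriv, ramanujan_E₄, ((h2.mul h4).sub h6).qExpansion_smul,
      (h2.mul h4).qExpansion_sub h6, h2.qExpansion_mul h4]
  · rw [← h6.qExpansion_normalizedDeriv, ramanujan_E₆,
      ((h2.mul h6).sub (h4.mul h4)).qExpansion_smul, (h2.mul h6).qExpansion_sub (h4.mul h4),
      h2.qExpansion_mul h6, h4.qExpansion_mul h4]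
  · simp [E2_qExpansion_coeff]
  · rw [E₄_qExpansion_coeff, if_pos rfl]
  · rw [E₆_qExpansion_coeff, if_pos rfl]
  · simp [E2_qExpansion_coeff]
  · rw [E₄_qExpansion_coeff, if_neg one_ne_zero]; simp
  · rw [E₆_qExpansion_coeff, if_neg one_ne_zero]; simp

lemma qExpansion_E2_mem (S : Subalgebra ℤ ℂ) :
    qExpansion 1 EisensteinSeries.E2 ∈ coeffSubalgebra S := fun n => by
  rw [E2_qExpansion_coeff]
  split_ifs
  exacts [one_mem S, mul_mem (by exact_mod_cast intCast_mem S (-24)) (natCast_mem S _)]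

lemma qExpansion_E₄_mem (S : Subalgebra ℤ ℂ) : qExpansion 1 E₄ ∈ coeffSubalgebra S := fun n => by
  rw [E₄_qExpansion_coeff]
  split_ifs
  exacts [one_mem S, mul_mem (by exact_mod_cast intCast_mem S 240) (natCast_mem S _)]

lemma qExpansion_E₆_mem (S : Subalgebra ℤ ℂ) : qExpansion 1 E₆ ∈ coeffSubalgebra S := fun n => by
  rw [E₆_qExpansion_coeff]
  split_ifs
  exacts [one_mem S, mul_mem (by exact_mod_cast intCast_mem S (-504)) (natCast_mem S _)]

/-- The pair of normalized extremal quasimodular forms of depth one and of weights `6 n` and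
`6 n + 2`. -/
noncomputable def extremalPair : ℕ → (ℍ → ℂ) × (ℍ → ℂ)
  | 0 => (1, EisensteinSeries.E2)
  | n + 1 =>
    (-(((n + 1 : ℕ) : ℂ) * ((144 * (6 * n + 5) : ℕ) : ℂ)⁻¹) •
        (⇑E₆ * (extremalPair n).1 - ⇑E₄ * (extremalPair n).2),
      (((n + 1 : ℕ) : ℂ) * ((144 * (6 * n + 7) : ℕ) : ℂ)⁻¹) •
        (⇑E₄ * ⇑E₄ * (extremalPair n).1 - ⇑E₆ * (extremalPair n).2))

lemma isQRegular_extremalPair (n : ℕ) :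
    IsQRegular (extremalPair n).1 ∧ IsQRegular (extremalPair n).2 := by
  have h4 := IsQRegular.of_modularForm E₄
  have h6 := IsQRegular.of_modularForm E₆
  induction n with
  | zero => exact ⟨.const 1, E2_isQRegular⟩
  | succ n ih =>
    exact ⟨((h6.mul ih.1).sub (h4.mul ih.2)).smul _,
      (((h4.mul h4).mul ih.1).sub (h6.mul ih.2)).smul _⟩

lemma qExpansion_extremalPair_zero :
    qExpansion 1 (extremalPair 0).1 = 1 ∧
      qExpansion 1 (extremalPair 0).2 = qExpansion 1 EisensteinSeries.E2 :=
  ⟨UpperHalfPlane.qExpansion_one 1, rfl⟩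

lemma qExpansion_extremalPair_succ (n : ℕ) :
    qExpansion 1 (extremalPair (n + 1)).1 =
        -(((n + 1 : ℕ) : ℂ) * ((144 * (6 * n + 5) : ℕ) : ℂ)⁻¹) •
          (qExpansion 1 E₆ * qExpansion 1 (extremalPair n).1 -
            qExpansion 1 E₄ * qExpansion 1 (extremalPair n).2) ∧
      qExpansion 1 (extremalPair (n + 1)).2 =
        (((n + 1 : ℕ) : ℂ) * ((144 * (6 * n + 7) : ℕ) : ℂ)⁻¹) •
          (qExpansion 1 E₄ * qExpansion 1 E₄ * qExpansion 1 (extremalPair n).1 -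
            qExpansion 1 E₆ * qExpansion 1 (extremalPair n).2) := by
  have h4 := IsQRegular.of_modularForm E₄
  have h6 := IsQRegular.of_modularForm E₆
  obtain ⟨hF, hG⟩ := isQRegular_extremalPair n
  rw [extremalPair, ((h6.mul hF).sub (h4.mul hG)).qExpansion_smul,
    (h6.mul hF).qExpansion_sub (h4.mul hG), h6.qExpansion_mul hF, h4.qExpansion_mul hG,
    (((h4.mul h4).mul hF).sub (h6.mul hG)).qExpansion_smul,
    ((h4.mul h4).mul hF).qExpansion_sub (h6.mul hG), (h4.mul h4).qExpansion_mul hF,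
    h4.qExpansion_mul h4, h6.qExpansion_mul hG]
  exact ⟨rfl, rfl⟩

lemma isExtremalPair_extremalPair (n : ℕ) :
    IsExtremalPair (qExpansion 1 EisensteinSeries.E2) (qExpansion 1 E₄) n
      (qExpansion 1 (extremalPair n).1) (qExpansion 1 (extremalPair n).2) := by
  induction n with
  | zero =>
    rw [qExpansion_extremalPair_zero.1]
    exact eisenstein_isRamanujanTriple.isExtremalPair_zero
  | succ n ih =>
    rw [(qExpansion_extremalPair_succ n).1, (qExpansion_extremalPair_succ n).2]
    exact eisenstein_isRamanujanTriple.isExtremalPair_succ ih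

lemma qExpansion_extremalPair_mem (n : ℕ) :
    qExpansion 1 (extremalPair n).1 ∈ coeffSubalgebra (intAdjoinInvPrimes (6 * n + 2)) ∧
      qExpansion 1 (extremalPair n).2 ∈ coeffSubalgebra (intAdjoinInvPrimes (6 * n + 2)) := by
  induction n with
  | zero =>
    rw [qExpansion_extremalPair_zero.1]
    exact ⟨one_mem _, qExpansion_E2_mem _⟩
  | succ n ih =>
    have hmono := coeffSubalgebra_mono
      (intAdjoinInvPrimes_mono (show 6 * n + 2 ≤ 6 * (n + 1) + 2 by omega))
    -- Applied to d = 6n+5 and d = 6n+7, both below the new weight 6n+8; the factor 144 adds only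
    -- the primes 2 and 3.
    have hinv : ∀ d : ℕ, d ≠ 0 → d < 6 * (n + 1) + 2 →
        (((144 * d : ℕ) : ℂ))⁻¹ ∈ intAdjoinInvPrimes (6 * (n + 1) + 2) := fun d hd hdn => by
      refine inv_natCast_mem_intAdjoinInvPrimes (by omega) fun p hp hpd => ?_
      rcases hp.dvd_mul.mp hpd with h | h
      · rw [show 144 = 12 ^ 2 by norm_num] at h
        have h12 := hp.dvd_of_dvd_pow h
        rw [show 12 = 3 * 4 by norm_num] at h12
        rcases hp.dvd_mul.mp h12 with h | h
        · have := Nat.le_of_dvd (by norm_num) h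
          omega
        · have := Nat.le_of_dvd (by norm_num) h
          omega
      · exact (Nat.le_of_dvd (by omega) h).trans_lt hdn
    rw [(qExpansion_extremalPair_succ n).1, (qExpansion_extremalPair_succ n).2]
    have hF := hmono ih.1
    have hG := hmono ih.2
    exact ⟨smul_mem_coeffSubalgebra (neg_mem (mul_mem (natCast_mem _ _)
        (hinv _ (by omega) (by omega))))
        (sub_mem (mul_mem (qExpansion_E₆_mem _) hF) (mul_mem (qExpansion_E₄_mem _) hG)),
      smul_mem_coeffSubalgebra (mul_mem (natCast_mem _ _) (hinv _ (by omega) (by omega)))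
        (sub_mem (mul_mem (mul_mem (qExpansion_E₄_mem _) (qExpansion_E₄_mem _)) hF)
          (mul_mem (qExpansion_E₆_mem _) hG))⟩

/-! ### Quasimodular spaces: membership, dimension, coordinates. -/

lemma mul_mem_quasimodularSpace {ℓ w v : ℕ} (g : ModularForm 𝒮ℒ (v : ℤ)) {f : ℍ → ℂ}
    (hf : f ∈ quasimodularSpace ℓ w) : ⇑g * f ∈ quasimodularSpace ℓ (w + v) := by
  obtain ⟨h, hh⟩ := hf
  refine ⟨fun j => ModularForm.mcast (by push_cast; ring) (g.mul (h j)), fun z => ?_⟩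
  rw [Pi.mul_apply, hh z, Finset.mul_sum]
  refine Finset.sum_congr rfl fun j _ => ?_
  rw [ModularForm.mcast_apply, ModularForm.coe_mul, Pi.mul_apply, mul_assoc]

lemma one_mem_quasimodularSpace : (1 : ℍ → ℂ) ∈ quasimodularSpace 1 0 :=
  ⟨fun j => if hj : j = 0 then ModularForm.mcast (by simp [hj]) (1 : ModularForm 𝒮ℒ 0) else 0,
    fun z => by simp [Finset.sum_range_succ]⟩

lemma E2_mem_quasimodularSpace : EisensteinSeries.E2 ∈ quasimodularSpace 1 2 :=
  ⟨fun j => if hj : j = 1 then ModularForm.mcast (by simp [hj]) (1 : ModularForm 𝒮ℒ 0) else 0,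
    fun z => by simp [Finset.sum_range_succ]⟩

lemma extremalPair_mem (n : ℕ) :
    (extremalPair n).1 ∈ quasimodularSpace 1 (6 * n) ∧
      (extremalPair n).2 ∈ quasimodularSpace 1 (6 * n + 2) := by
  induction n with
  | zero => exact ⟨one_mem_quasimodularSpace, E2_mem_quasimodularSpace⟩
  | succ n ih =>
    have e1 := mul_mem_quasimodularSpace (v := 6) E₆ ih.1
    have e2 := mul_mem_quasimodularSpace (v := 4) E₄ ih.2
    have e3 := mul_mem_quasimodularSpace (v := 4) E₄ (mul_mem_quasimodularSpace (v := 4) E₄ ih.1)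
    have e4 := mul_mem_quasimodularSpace (v := 6) E₆ ih.2
    rw [← mul_assoc] at e3
    exact ⟨Submodule.smul_mem _ _ (sub_mem e1 e2), Submodule.smul_mem _ _ (sub_mem e3 e4)⟩

lemma isQRegular_of_mem {ℓ w : ℕ} {f : ℍ → ℂ} (hf : f ∈ quasimodularSpace ℓ w) :
    IsQRegular f := by
  obtain ⟨g, hg⟩ := hf
  have hsum : ∀ s : Finset ℕ, IsQRegular (∑ j ∈ s, ⇑(g j) * EisensteinSeries.E2 ^ j) := by
    intro s
    induction s using Finset.cons_induction with
    | empty => simpa using! IsQRegular.const 0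
    | cons a s ha ih =>
      rw [Finset.sum_cons]
      exact ((IsQRegular.of_modularForm (g a)).mul (E2_isQRegular.pow a)).add ih
  convert! hsum (Finset.range (ℓ + 1)) using 1
  ext z
  simp [hg z]

/-- The first `N` Fourier coefficients, as a linear map on quasimodular forms. -/
noncomputable def fourierCoeffMap (ℓ w N : ℕ) : quasimodularSpace ℓ w →ₗ[ℂ] (Fin N → ℂ) where
  toFun f i := fourierCoeffQ f i
  map_add' f g := by
    ext i
    simp [fourierCoeffQ, (isQRegular_of_mem f.2).qExpansion_add (isQRegular_of_mem g.2)]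
  map_smul' c f := by
    ext i
    simp [fourierCoeffQ, (isQRegular_of_mem f.2).qExpansion_smul]

/-- The parametrization of quasimodular forms of depth at most one by pairs of modular forms. -/
noncomputable def depthOneMap (w : ℕ) :
    ModularForm 𝒮ℒ ((w : ℤ) - 2 * ((0 : ℕ) : ℤ)) × ModularForm 𝒮ℒ ((w : ℤ) - 2 * ((1 : ℕ) : ℤ))
      →ₗ[ℂ] quasimodularSpace 1 w where
  toFun p := ⟨fun z => p.1 z + p.2 z * EisensteinSeries.E2 z,
    fun j => match j with | 0 => p.1 | 1 => p.2 | _ + 2 => 0,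
    fun z => by simp [Finset.sum_range_succ]⟩
  map_add' p q := by
    ext z
    simp
    ring
  map_smul' c p := by
    ext z
    simp
    ring

lemma depthOneMap_surjective (w : ℕ) : Function.Surjective (depthOneMap w) := by
  rintro ⟨f, g, hg⟩
  refine ⟨(g 0, g 1), Subtype.ext (funext fun z => ?_)⟩
  refine Eq.trans ?_ (hg z).symm
  simp [depthOneMap, Finset.sum_range_succ]

instance (w : ℕ) : FiniteDimensional ℂ (quasimodularSpace 1 w) :=
  Module.Finite.of_surjective _ (depthOneMap_surjective w)

lemma finrank_modularForm_levelOne (k : ℕ) (hk : Even k) :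
    Module.finrank ℂ (ModularForm 𝒮ℒ (k : ℤ)) =
      if k ≡ 2 [MOD 12] then k / 12 else k / 12 + 1 := by
  refine Module.finrank_eq_of_rank_eq ?_
  rw [ModularForm.dimension_level_one k hk]

/-- The bound is dim M_{6k+2} + dim M_{6k}. Linear independence of 1 and E₂ over modular forms is
not needed: the reverse inequality comes from `fourierCoeffMap_surjective`. -/
lemma finrank_quasimodularSpace_one_le (k : ℕ) :
    Module.finrank ℂ (quasimodularSpace 1 (6 * k + 2)) ≤ k + 1 := by
  refine (LinearMap.finrank_le_finrank_of_surjective (depthOneMap_surjective _)).trans ?_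
  rw [Module.finrank_prod,
    show ((6 * k + 2 : ℕ) : ℤ) - 2 * ((0 : ℕ) : ℤ) = ((6 * k + 2 : ℕ) : ℤ) by simp,
    show ((6 * k + 2 : ℕ) : ℤ) - 2 * ((1 : ℕ) : ℤ) = ((6 * k : ℕ) : ℤ) by push_cast; ring,
    finrank_modularForm_levelOne _ ⟨3 * k + 1, by ring⟩,
    finrank_modularForm_levelOne _ ⟨3 * k, by ring⟩]
  obtain ⟨a, rfl | rfl⟩ := Nat.even_or_odd' k
  · rw [if_pos (show 6 * (2 * a) + 2 ≡ 2 [MOD 12] by unfold Nat.ModEq; omega),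
      if_neg (show ¬ 6 * (2 * a) ≡ 2 [MOD 12] by unfold Nat.ModEq; omega)]
    omega
  · rw [if_neg (show ¬ 6 * (2 * a + 1) + 2 ≡ 2 [MOD 12] by unfold Nat.ModEq; omega),
      if_neg (show ¬ 6 * (2 * a + 1) ≡ 2 [MOD 12] by unfold Nat.ModEq; omega)]
    omega

/-- For every `j ≤ k` there is a quasimodular form of weight `6 k + 2` and depth at most one with
leading term `q ^ j`. -/
lemma exists_quasimodular_leading_term {k j : ℕ} (hj : j ≤ k) :
    ∃ f ∈ quasimodularSpace 1 (6 * k + 2),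
      (∀ i < j, fourierCoeffQ f i = 0) ∧ fourierCoeffQ f j = 1 := by
  obtain ⟨i, rfl⟩ := Nat.exists_eq_add_of_le hj
  have h6 := IsQRegular.of_modularForm E₆
  have hG := (isQRegular_extremalPair j).2
  have hpair := isExtremalPair_extremalPair j
  -- Here i = k - j: the factor E₆^i fills up the weight from 6j + 2 to 6k + 2 and has constant term
  -- 1.
  refine ⟨(⇑E₆) ^ i * (extremalPair j).2, ?_, ?_⟩
  · have h := mul_mem_quasimodularSpace (v := 6 * i)
      (ModularForm.mcast (by push_cast; ring) (E₆.pow i)) (extremalPair_mem j).2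
    rw [ModularForm.coe_mcast, ModularForm.coe_pow] at h
    convert! h using 2
    ring
  · obtain ⟨g, hg⟩ := hpair.dvd_G
    have hg0 : g.coeff 0 = 1 := by
      simpa [hg, PowerSeries.coeff_X_pow_mul'] using hpair.coeff_G
    have h60 := eisenstein_isRamanujanTriple.coeff_zero_R
    simp only [fourierCoeffQ, (h6.pow i).qExpansion_mul hG, h6.qExpansion_pow, hg]
    rw [show qExpansion 1 E₆ ^ i * (PowerSeries.X ^ j * g) =
      PowerSeries.X ^ j * (qExpansion 1 E₆ ^ i * g) by ring]
    simp only [PowerSeries.coeff_zero_eq_constantCoeff] at hg0 h60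
    refine ⟨fun m hm => ?_, ?_⟩
    · rw [PowerSeries.coeff_X_pow_mul', if_neg (by omega)]
    · simp [PowerSeries.coeff_X_pow_mul', hg0, h60]

lemma fourierCoeffMap_surjective (k : ℕ) :
    Function.Surjective (fourierCoeffMap 1 (6 * k + 2) (k + 1)) := by
  choose f hmem hzero hone using fun j : Fin (k + 1) =>
    exists_quasimodular_leading_term (Nat.lt_succ_iff.mp j.2)
  let v : Fin (k + 1) → Fin (k + 1) → ℂ :=
    fun j => fourierCoeffMap 1 (6 * k + 2) (k + 1) ⟨f j, hmem j⟩
  have hv : LinearIndependent ℂ v := by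
    refine Matrix.linearIndependent_rows_of_det_ne_zero (A := Matrix.of v) ?_
    -- Leading terms q^j make the coefficient matrix unitriangular.
    rw [Matrix.det_of_isUpperTriangular]
    · refine Finset.prod_ne_zero_iff.mpr fun j _ => ?_
      change fourierCoeffQ (f j) j ≠ 0
      rw [hone]
      exact one_ne_zero
    · intro i j hij
      exact hzero i j hij
  rw [← LinearMap.range_eq_top, eq_top_iff,
    ← hv.span_eq_top_of_card_eq_finrank' (by simp), Submodule.span_le]
  rintro _ ⟨j, rfl⟩
  exact ⟨_, rfl⟩

lemma finrank_quasimodularSpace_one (k : ℕ) :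
    Module.finrank ℂ (quasimodularSpace 1 (6 * k + 2)) = k + 1 := by
  refine le_antisymm (finrank_quasimodularSpace_one_le k) ?_
  simpa using LinearMap.finrank_le_finrank_of_surjective (fourierCoeffMap_surjective k)

lemma fourierCoeffMap_injective (k : ℕ) :
    Function.Injective (fourierCoeffMap 1 (6 * k + 2) (k + 1)) :=
  (LinearMap.injective_iff_surjective_of_finrank_eq_finrank
    (by simp [finrank_quasimodularSpace_one])).mpr (fourierCoeffMap_surjective k)

/-! ### Exact depth, extremality and uniqueness. -/

lemma extremalPair_snd_not_mem (k : ℕ) :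
    (extremalPair k).2 ∉ quasimodularSpace 0 (6 * k + 2) := by
  rintro ⟨g, hg⟩
  have hpair := isExtremalPair_extremalPair k
  have hcast : ((6 * k + 2 : ℕ) : ℤ) - 2 * ((0 : ℕ) : ℤ) = ((6 * k + 2 : ℕ) : ℤ) := by simp
  let f : ModularForm 𝒮ℒ ((6 * k + 2 : ℕ) : ℤ) := ModularForm.mcast hcast (g 0)
  have hf : (extremalPair k).2 = f := by
    ext z
    rw [hg z]
    simp [f]
  have hf0 : f ≠ 0 := by
    intro h0
    have := hpair.coeff_G
    rw [hf, h0, FunLike.coe_zero, UpperHalfPlane.qExpansion_zero] at this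
    simp at this
  apply hf0
  -- For k > 0 the Sturm bound ⌊(6k+2)/12⌋ is less than k. For k = 0 it gives nothing, but there are
  -- no nonzero forms of weight 2.
  rcases Nat.eq_zero_or_pos k with rfl | hk
  · exact rank_zero_iff_forall_zero.mp ModularForm.levelOne_weight_two_rank_zero f
  · apply ModularForm.sturm_bound_levelOne_nat
    rw [← hf]
    refine lt_of_lt_of_le ?_ (PowerSeries.nat_le_order _ k
      (PowerSeries.X_pow_dvd_iff.mp hpair.dvd_G))
    exact_mod_cast (by omega : (6 * k + 2) / 12 < k)

lemma isNormalizedExtremalQuasimodular_extremalPair (k : ℕ) :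
    IsNormalizedExtremalQuasimodular 1 (6 * k + 2) (extremalPair k).2 := by
  have hpair := isExtremalPair_extremalPair k
  have hone : fourierCoeffQ (extremalPair k).2
      (Module.finrank ℂ (quasimodularSpace 1 (6 * k + 2)) - 1) = 1 := by
    rw [finrank_quasimodularSpace_one, Nat.add_sub_cancel]
    exact hpair.coeff_G
  refine ⟨⟨(extremalPair_mem k).2, ?_, ?_, hone ▸ one_ne_zero⟩, hone⟩
  · intro j hj
    obtain rfl : j = 0 := by omega
    exact extremalPair_snd_not_mem k
  · intro n hn
    rw [finrank_quasimodularSpace_one] at hn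
    exact PowerSeries.X_pow_dvd_iff.mp hpair.dvd_G n (by omega)

lemma IsNormalizedExtremalQuasimodular.eq_extremalPair {k : ℕ} {f : ℍ → ℂ}
    (hf : IsNormalizedExtremalQuasimodular 1 (6 * k + 2) f) : f = (extremalPair k).2 := by
  have hcoeff : ∀ g : ℍ → ℂ, IsNormalizedExtremalQuasimodular 1 (6 * k + 2) g →
      ∀ i < k + 1, fourierCoeffQ g i = if i = k then 1 else 0 := by
    intro g hg i hi
    split_ifs with h
    · simpa [finrank_quasimodularSpace_one, h] using hg.normalized
    · exact hg.extremal.coeff_eq_zero i (by rw [finrank_quasimodularSpace_one]; omega)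
  have hk := isNormalizedExtremalQuasimodular_extremalPair k
  have h := @fourierCoeffMap_injective k ⟨f, hf.extremal.mem⟩ ⟨_, hk.extremal.mem⟩ (funext fun i =>
    (hcoeff f hf i i.2).trans (hcoeff _ hk i i.2).symm)
  exact congrArg Subtype.val h

theorem mainTheorem1 (k : ℕ) :
    (∃! f : ℍ → ℂ, IsNormalizedExtremalQuasimodular 1 (6 * k + 2) f) ∧
    ∀ f : ℍ → ℂ, IsNormalizedExtremalQuasimodular 1 (6 * k + 2) f → ∀ n : ℕ,
      fourierCoeffQ f n ∈ intAdjoinInvPrimes (6 * k + 2) ∧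
      ∃ r : ℚ, fourierCoeffQ f n = (r : ℂ) ∧
        ∀ p : ℕ, p.Prime → p ∣ r.den → p < 6 * k + 2 := by
  refine ⟨⟨_, isNormalizedExtremalQuasimodular_extremalPair k, fun f hf => hf.eq_extremalPair⟩,
    fun f hf n => ?_⟩
  rw [hf.eq_extremalPair]
  have hmem : fourierCoeffQ (extremalPair k).2 n ∈ intAdjoinInvPrimes (6 * k + 2) :=
    (qExpansion_extremalPair_mem k).2 n
  exact ⟨hmem, exists_rat_of_mem_intAdjoinInvPrimes hmem⟩
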